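/- Let $\mathbb{F}$ be an algebraically closed field of characteristic zero. For integers $n,d\ge 0$ let $\mathrm{Ten}(n,d)=(\mathbb{F}^n)^{\otimes d}$, and let $S\subseteq \mathrm{Ten}(n,d)$ be the set of simple tensors $v_1\otimes\cdots\otimes v_d$ with $v_i\in\mathbb{F}^n$. The tensor rank of a tensor is the smallest $r$ such that it is a sum of $r$ simple tensors, and its border rank $\mathrm{brk}(T)$ is the smallest $r$ such that $T$ lies in the Zariski closure of the set of tensors of tensor rank at most $r$. Let $n,d,m\ge 0$ and $k\ge 1$ be integers, and let $\phi:\mathrm{Ten}(n,d)\to\mathrm{Ten}(m,k)$ be a linear map. Its border potency is $$\mathrm{Bpot}(\phi)=\frac{\max\{\mathrm{brk}(\phi(T)) : T\in\mathrm{Ten}(n,d)\}}{\max\{\mathrm{brk}(\phi(s)) : s\in S\}},$$ where $\mathrm{Bpot}(0)$ is taken to be $0$. Then $$\mathrm{Bpot}(\phi)\le k^d\cdot n^{\lfloor (k-1)d/k\rfloor}$$ (with the convention $0^0=1$). -/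

import Mathlib

open scoped TensorProduct

namespace BorderPotency

/-- The `S`-rank of `v`: the smallest `r` such that `v` is a sum of `r` elements of `S`. -/
noncomputable def sRank {V : Type*} [AddCommMonoid V] (S : Set V) (v : V) : ℕ :=
  sInf {r : ℕ | ∃ s : Fin r → V, (∀ i, s i ∈ S) ∧ v = ∑ i, s i}

/-- The Zariski closure of a subset `Z` of an `F`-vector space `V` (meant for finite-dimensional
`V`): the common zeros of all polynomial functions that vanish on `Z`. A polynomial function is a
polynomial expression in linear functionals. -/
def zariskiClosure (F : Type*) [Field F] {V : Type*} [AddCommGroup V] [Module F V]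
    (Z : Set V) : Set V :=
  {x | ∀ p : MvPolynomial (Module.Dual F V) F,
    (∀ z ∈ Z, MvPolynomial.eval (fun l : Module.Dual F V => l z) p = 0) →
      MvPolynomial.eval (fun l : Module.Dual F V => l x) p = 0}

/-- `Ten F n d` is the `d`-fold tensor power of `F ^ n`. -/
abbrev Ten (F : Type*) [Field F] (n d : ℕ) : Type _ :=
  ⨂[F] _ : Fin d, (Fin n → F)

/-- The simple tensors `v₁ ⊗ ⋯ ⊗ v_d`. -/
def simpleTensors (F : Type*) [Field F] (n d : ℕ) : Set (Ten F n d) :=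
  {T | ∃ v : Fin d → Fin n → F, T = PiTensorProduct.tprod F v}

/-- Tensor rank. -/
noncomputable def tensorRank {F : Type*} [Field F] {n d : ℕ} (T : Ten F n d) : ℕ :=
  sRank (simpleTensors F n d) T

/-- (Topological) border rank: the smallest `r` such that `T` lies in the Zariski closure of the
set of tensors of rank at most `r`. -/
noncomputable def borderRank {F : Type*} [Field F] {n d : ℕ} (T : Ten F n d) : ℕ :=
  sInf {r : ℕ | T ∈ zariskiClosure F {T' : Ten F n d | tensorRank T' ≤ r}}

/-- The largest border rank of a tensor in `φ '' A`. The maximum is attained when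
`1 ≤ k` and `A` is nonempty, see `isGreatest_maxBorderRank`. -/
noncomputable def maxBorderRank {F : Type*} [Field F] {n d m k : ℕ}
    (φ : Ten F n d →ₗ[F] Ten F m k) (A : Set (Ten F n d)) : ℕ :=
  sSup ((fun T => borderRank (φ T)) '' A)

/-- The border potency of a linear map `φ`: the largest border rank on the image of `φ`, divided
by the largest border rank on the image of the simple tensors. For `1 ≤ k` the denominator
vanishes only for `φ = 0`, see `maxBorderRank_simpleTensors_pos`; then the value is `0`. -/
noncomputable def borderPotency {F : Type*} [Field F] {n d m k : ℕ}
    (φ : Ten F n d →ₗ[F] Ten F m k) : ℝ :=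
  (maxBorderRank φ Set.univ : ℝ) / (maxBorderRank φ (simpleTensors F n d) : ℝ)

section wellDefined

theorem span_simpleTensors (F : Type*) [Field F] (n d : ℕ) :
    Submodule.span F (simpleTensors F n d) = ⊤ := by
  rw [← PiTensorProduct.span_tprod_eq_top (R := F) (s := fun _ : Fin d => Fin n → F)]
  congr 1
  ext T
  simp [simpleTensors, eq_comm]

theorem smul_mem_simpleTensors {F : Type*} [Field F] {n d : ℕ} (hd : 1 ≤ d) (c : F)
    {T : Ten F n d} (hT : T ∈ simpleTensors F n d) : c • T ∈ simpleTensors F n d := by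
  obtain ⟨v, rfl⟩ := hT
  refine ⟨Function.update v ⟨0, hd⟩ (c • v ⟨0, hd⟩), ?_⟩
  rw [MultilinearMap.map_update_smul, Function.update_eq_self]

/-- For `1 ≤ d` every tensor is a sum of boundedly many simple tensors. -/
theorem exists_sum_simpleTensors (F : Type*) [Field F] (n d : ℕ) (hd : 1 ≤ d) :
    ∃ N : ℕ, ∀ T : Ten F n d, ∃ s : Fin N → Ten F n d,
      (∀ i, s i ∈ simpleTensors F n d) ∧ T = ∑ i, s i := by
  have hfg : (Submodule.span F (simpleTensors F n d)).FG := by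
    rw [span_simpleTensors]
    exact Module.Finite.fg_top
  obtain ⟨B, hB, hspan⟩ := Submodule.fg_span_iff_fg_span_finset_subset _ |>.1 hfg
  refine ⟨B.card, fun T => ?_⟩
  have hT : T ∈ Submodule.span F (B : Set (Ten F n d)) := by
    rw [← hspan, span_simpleTensors]
    exact Submodule.mem_top
  obtain ⟨c, -, hc⟩ := Submodule.mem_span_finset.1 hT
  refine ⟨fun i => c (B.equivFin.symm i : Ten F n d) • (B.equivFin.symm i : Ten F n d),
    fun i => smul_mem_simpleTensors hd _ (hB (B.equivFin.symm i).2), ?_⟩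
  rw [Equiv.sum_comp B.equivFin.symm (fun b : B => c (b : Ten F n d) • (b : Ten F n d)),
    Finset.sum_coe_sort B (fun b => c b • b), hc]

theorem subset_zariskiClosure (F : Type*) [Field F] {V : Type*} [AddCommGroup V] [Module F V]
    (Z : Set V) : Z ⊆ zariskiClosure F Z :=
  fun x hx _ hp => hp x hx

/-- For `1 ≤ d` the minimum in the definition of tensor rank is attained. -/
theorem tensorRank_spec {F : Type*} [Field F] {n d : ℕ} (hd : 1 ≤ d) (T : Ten F n d) :
    ∃ s : Fin (tensorRank T) → Ten F n d,
      (∀ i, s i ∈ simpleTensors F n d) ∧ T = ∑ i, s i := by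
  obtain ⟨N, hN⟩ := exists_sum_simpleTensors F n d hd
  exact Nat.sInf_mem (s := {r : ℕ | ∃ s : Fin r → Ten F n d,
    (∀ i, s i ∈ simpleTensors F n d) ∧ T = ∑ i, s i}) ⟨N, hN T⟩

/-- The minimum in the definition of border rank is attained. -/
theorem borderRank_spec {F : Type*} [Field F] {n d : ℕ} (T : Ten F n d) :
    T ∈ zariskiClosure F {T' : Ten F n d | tensorRank T' ≤ borderRank T} :=
  Nat.sInf_mem (s := {r : ℕ | T ∈ zariskiClosure F {T' : Ten F n d | tensorRank T' ≤ r}})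
    ⟨tensorRank T, subset_zariskiClosure F _ (le_refl (tensorRank T))⟩

theorem borderRank_le_tensorRank {F : Type*} [Field F] {n d : ℕ} (T : Ten F n d) :
    borderRank T ≤ tensorRank T :=
  Nat.sInf_le (subset_zariskiClosure F _ (le_refl (tensorRank T)))

theorem isGreatest_maxBorderRank {F : Type*} [Field F] {n d m k : ℕ} (hk : 1 ≤ k)
    (φ : Ten F n d →ₗ[F] Ten F m k) {A : Set (Ten F n d)} (hA : A.Nonempty) :
    IsGreatest ((fun T => borderRank (φ T)) '' A) (maxBorderRank φ A) := by
  obtain ⟨N, hN⟩ := exists_sum_simpleTensors F m k hk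
  have hb : BddAbove ((fun T => borderRank (φ T)) '' A) := by
    refine ⟨N, ?_⟩
    rintro _ ⟨T, -, rfl⟩
    exact (borderRank_le_tensorRank _).trans (Nat.sInf_le (hN (φ T)))
  exact ⟨Nat.sSup_mem (hA.image _) hb, fun _ h => le_csSup hb h⟩

theorem eq_zero_of_borderRank_eq_zero {F : Type*} [Field F] {n d : ℕ} (hd : 1 ≤ d)
    {T : Ten F n d} (hT : borderRank T = 0) : T = 0 := by
  have h := borderRank_spec T
  rw [hT] at h
  refine (Module.forall_dual_apply_eq_zero_iff F T).1 fun l => ?_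
  have := h (MvPolynomial.X l) fun z hz => by
    obtain ⟨s, -, hs⟩ := tensorRank_spec hd z
    have h0 : tensorRank z = 0 := Nat.le_zero.1 hz
    have : IsEmpty (Fin (tensorRank z)) := by rw [h0]; infer_instance
    rw [Finset.univ_eq_empty, Finset.sum_empty] at hs
    simp [hs]
  simpa using this

theorem maxBorderRank_simpleTensors_pos {F : Type*} [Field F] {n d m k : ℕ} (hk : 1 ≤ k)
    (φ : Ten F n d →ₗ[F] Ten F m k) (hφ : φ ≠ 0) :
    0 < maxBorderRank φ (simpleTensors F n d) := by
  by_contra h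
  have hg := isGreatest_maxBorderRank hk φ (A := simpleTensors F n d) ⟨_, 0, rfl⟩
  refine hφ (LinearMap.ext_on (span_simpleTensors F n d) fun T hT => ?_)
  have := hg.2 ⟨T, hT, rfl⟩
  exact eq_zero_of_borderRank_eq_zero hk (by simp only at this; omega)

end wellDefined

end BorderPotency

/-! Let `K` be the field of rational functions over `F` in the `d * n` entries of generic vectors
`x_1, …, x_d`, and let `p` be the image under `φ` of the generic simple tensor. Since `p` is
multilinear in the `x_l`, `φ(e_J)` is the mixed partial derivative `∂_J p`, one derivative for each
slot, so `φ(T) = ∑ J, T_J ∂_J p`. Suppose first that `p` is a sum of `r` products of `k` vectors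
over `K`. The Leibniz rule turns each product into `k ^ d` terms, one for each assignment `f` of
derivatives to factors (`iterDer_prod`). In such a term the `j`-th factor depends on `J` only
through the slots in the fibre of `j`. Some fibre has at least `d / k` slots; absorbing the sum over
their indices into one factor leaves at most `n ^ ⌊(k - 1) d / k⌋` products
(`CoordRankLE.contraction`). In general `p` is only a limit of tensors of rank at most `r`. By curve
selection it is the specialization of such a tensor over an extension `E` of `K` with a discrete
valuation. The derivations of `K` extend to `E` so that they preserve the valuation ring and its
maximal ideal (`exists_differential_lift`). The argument above then works over `E`, and its result
specializes to `φ(T)` (`eval_contraction_eq_zero`). -/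

open Polynomial

namespace BorderPotency

/-! ### Extending derivations and bounding them on valuation rings -/

section Derivations

/-- Derivations extend along formally étale maps. -/
theorem exists_derivation_extension {S T : Type*} [CommRing S] [CommRing T] [Algebra S T]
    [Algebra.FormallyEtale S T] (D : Derivation ℤ S T) :
    ∃ D' : Derivation ℤ T T, ∀ s, D' (algebraMap S T s) = D s := by
  let e := KaehlerDifferential.tensorKaehlerEquivOfFormallyEtale ℤ S T
  let L : T ⊗[S] Ω[S⁄ℤ] →ₗ[T] T := LinearMap.liftBaseChange T D.liftKaehlerDifferential
  refine ⟨(L ∘ₗ e.symm.toLinearMap).compDer (KaehlerDifferential.D ℤ T), fun s => ?_⟩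
  have h := KaehlerDifferential.tensorKaehlerEquivOfFormallyEtale_symm_D_algebraMap ℤ S T s
  change L (e.symm (KaehlerDifferential.D ℤ T (algebraMap S T s))) = D s
  rw [h]
  simp [L]

/-- `D` acts on coefficients and kills `X`; in characteristic zero `E` is formally étale over
`K[X]`, so this extends. The last clause later bounds `D'` on the integral closure of `K[X]`. -/
theorem exists_derivation_extension_polynomial {K E : Type*} [Field K] [CharZero K] [Field E]
    [Algebra K[X] E] [Algebra K E] [IsScalarTower K K[X] E] [FaithfulSMul K[X] E]
    [Algebra.IsAlgebraic K[X] E] (D : Derivation ℤ K K) :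
    ∃ D' : Derivation ℤ E E, (∀ a, D' (algebraMap K E a) = algebraMap K E (D a)) ∧
      D' (algebraMap K[X] E X) = 0 ∧
      ∀ p : K[X], ∃ q : K[X], D' (algebraMap K[X] E p) = algebraMap K[X] E q := by
  let : Differential K := ⟨D⟩
  have hinj : Function.Injective (algebraMap K[X] E) := FaithfulSMul.algebraMap_injective _ _
  let : Algebra (FractionRing K[X]) E := FractionRing.liftAlgebra K[X] E
  have : IsScalarTower K[X] (FractionRing K[X]) E := FractionRing.isScalarTower_liftAlgebra _ _
  have : Algebra.IsAlgebraic (FractionRing K[X]) E := 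
    (IsFractionRing.comap_isAlgebraic_iff (A := K[X])).1 inferInstance
  have : CharZero (FractionRing K[X]) :=
    charZero_of_injective_algebraMap (R := K[X]) (IsFractionRing.injective _ _)
  have : Algebra.FormallyEtale (FractionRing K[X]) E := Algebra.FormallyEtale.of_isSeparable _ _
  have : Algebra.FormallyEtale K[X] (FractionRing K[X]) :=
    Algebra.FormallyEtale.of_isLocalization (nonZeroDivisors K[X])
  have : Algebra.FormallyEtale K[X] E := Algebra.FormallyEtale.comp _ (FractionRing K[X]) _
  obtain ⟨D', hD'⟩ := exists_derivation_extension (S := K[X]) (T := E)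
    ((Algebra.linearMap K[X] E).compDer Differential.mapCoeffs)
  have h : ∀ p : K[X], D' (algebraMap K[X] E p) =
    algebraMap K[X] E (Differential.mapCoeffs p) := hD'
  refine ⟨D', fun a => ?_, ?_, fun p => ⟨_, h p⟩⟩
  · have := h (C a)
    rw [Differential.mapCoeffs_C] at this
    rw [IsScalarTower.algebraMap_apply K K[X] E, IsScalarTower.algebraMap_apply K K[X] E]
    exact this
  · rw [h, Differential.mapCoeffs_X, map_zero]

open WithZero IsDedekindDomain

variable {K O E : Type*} [Field K] [CommRing O] [IsDedekindDomain O] [Field E]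
  [Algebra O E] [IsFractionRing O E] [Algebra K E] (v : HeightOneSpectrum O)

theorem valuation_algebraMap_field_le_one [Algebra K O] [IsScalarTower K O E] (a : K) : v.valuation E (algebraMap K E a) ≤ 1 := by
  rw [IsScalarTower.algebraMap_apply K O E]
  exact v.valuation_le_one _

theorem valuation_algebraMap_field_eq_one [Algebra K O] [IsScalarTower K O E] {a : K}
    (ha : a ≠ 0) :
    v.valuation E (algebraMap K E a) = 1 := by
  refine le_antisymm (valuation_algebraMap_field_le_one v a) ?_
  have h := valuation_algebraMap_field_le_one (E := E) v a⁻¹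
  rw [map_inv₀, map_inv₀] at h
  exact (inv_le_one₀ (by simpa [zero_lt_iff] using ha)).1 h

/-- Quotient rule: `x` is a fraction of elements of `O` whose denominator is a unit at `v`. -/
theorem valuation_derivation_le_of_integral (D : Derivation ℤ E E) {B : ℤᵐ⁰}
    (hB : ∀ x : O, v.valuation E (D (algebraMap O E x)) ≤ B) {x : E}
    (hx : v.valuation E x ≤ 1) : v.valuation E (D x) ≤ B := by
  obtain ⟨n, d, h⟩ := v.exists_primeCompl_mul_eq_of_integer x hx
  have hd : v.valuation E (algebraMap O E d) = 1 := v.valuation_eq_one_iff_notMem.2 d.2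
  have h1 : D x * algebraMap O E d = D (algebraMap O E n) - x * D (algebraMap O E d) := by
    rw [← h, D.leibniz]; simp only [smul_eq_mul]; ring
  have h2 : v.valuation E (D x) = v.valuation E (D x * algebraMap O E d) := by
    rw [map_mul, hd, mul_one]
  rw [h2, h1]
  refine (Valuation.map_sub _ _ _).trans (max_le (hB n) ?_)
  rw [map_mul]
  exact (mul_le_of_le_one_left' hx).trans (hB d)

/-- The difference is the value at `x` of the polynomial whose coefficients are differentiated. -/
theorem valuation_derivation_aeval_sub_le_one (D : Derivation ℤ E E)
    (hK : ∀ a : K, v.valuation E (D (algebraMap K E a)) ≤ 1) {x : E}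
    (hx : v.valuation E x ≤ 1) (p : K[X]) :
    v.valuation E (D (aeval x p) - aeval x (derivative p) * D x) ≤ 1 := by
  induction p using Polynomial.induction_on' with
  | add p q hp hq =>
    have : D (aeval x (p + q)) - aeval x (derivative (p + q)) * D x =
      (D (aeval x p) - aeval x (derivative p) * D x) +
        (D (aeval x q) - aeval x (derivative q) * D x) := by simp; ring
    rw [this]
    exact (Valuation.map_add _ _ _).trans (max_le hp hq)
  | monomial n a =>
    have : D (aeval x (monomial n a)) - aeval x (derivative (monomial n a)) * D x =
        x ^ n * D (algebraMap K E a) := by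
      simp [aeval_monomial, derivative_monomial, D.leibniz, D.leibniz_pow]
      ring
    rw [this, map_mul, map_pow]
    exact mul_le_one' (pow_le_one' hx n) (hK a)

variable [CharZero K] [Algebra K O] [IsScalarTower K O E]

/-- One improvement step for bounds on a derivation of a discretely valued field of residue
characteristic zero. -/
theorem valuation_derivation_improve (D : Derivation ℤ E E)
    (hK : ∀ a : K, v.valuation E (D (algebraMap K E a)) ≤ 1)
    (hres : Algebra.IsAlgebraic K (O ⧸ v.asIdeal))
    {ε : O} (hε : ε ∈ v.asIdeal) (hε0 : ε ≠ 0) (hDε : D (algebraMap O E ε) = 0)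
    {B : ℤᵐ⁰} (hB : ∀ x : O, v.valuation E (D (algebraMap O E x)) ≤ B) :
    (∀ x : E, v.valuation E x < 1 → v.valuation E (D x) ≤ B * exp (-1)) ∧
    ∀ x : O, v.valuation E (D (algebraMap O E x)) ≤ max 1 (B * exp (-1)) := by
  have hB' : ∀ x : E, v.valuation E x ≤ 1 → v.valuation E (D x) ≤ B := fun x hx =>
    valuation_derivation_le_of_integral v D hB hx
  obtain ⟨π, hπ⟩ := v.valuation_exists_uniformizer E
  have hπ0 : π ≠ 0 := by
    rintro rfl
    rw [map_zero] at hπ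
    exact exp_ne_zero hπ.symm
  have hε0' : algebraMap O E ε ≠ 0 := by simpa using hε0
  have hDπ : v.valuation E (D π) ≤ B * exp (-1) := by
    -- With `π ^ e = ε u` and `D ε = 0`, one gets `e π ^ (e - 1) D π = ε D u`. As `e` is a unit, `v
    -- (D π) = v π * v (D u)`.
    obtain ⟨e, he, hve⟩ : ∃ e : ℕ, e ≠ 0 ∧
        v.valuation E (algebraMap O E ε) = v.valuation E π ^ e := by
      have h1 : v.valuation E (algebraMap O E ε) < 1 := (v.valuation_lt_one_iff_mem ε).2 hε
      obtain ⟨z, hz⟩ : ∃ z : ℤ, v.valuation E (algebraMap O E ε) = exp z :=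
        ⟨_, (exp_log (by simpa using hε0)).symm⟩
      rw [hz, ← exp_zero, exp_lt_exp] at h1
      refine ⟨(-z).toNat, by omega, ?_⟩
      rw [hz, hπ, ← exp_nsmul]
      congr 1
      simp
      omega
    set u := π ^ e / algebraMap O E ε with hu
    have hvu : v.valuation E u = 1 := by
      rw [hu, map_div₀, hve, map_pow, div_self]
      exact pow_ne_zero _ (by simpa using hπ0)
    have h1 : π ^ e = algebraMap O E ε * u := by rw [hu]; field_simp
    have h2 : (e : E) * π ^ (e - 1) * D π = algebraMap O E ε * D u := by
      have := congrArg D h1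
      rw [D.leibniz_pow, D.leibniz, hDε] at this
      simpa [mul_assoc] using this
    have he1 : v.valuation E (e : E) = 1 := by
      rw [← map_natCast (algebraMap K E)]
      exact valuation_algebraMap_field_eq_one v (by exact_mod_cast he)
    have h3 := congrArg (v.valuation E) h2
    rw [map_mul, map_mul, map_mul, he1, one_mul, map_pow, hve] at h3
    obtain ⟨e', rfl⟩ := Nat.exists_eq_succ_of_ne_zero he
    have hp : v.valuation E π ≠ 0 := by simpa using hπ0
    rw [Nat.succ_sub_one, Nat.succ_eq_add_one, pow_succ, mul_assoc] at h3
    rw [mul_left_cancel₀ (pow_ne_zero _ hp) h3, hπ, mul_comm]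
    exact mul_le_mul_left (hB' u hvu.le) _
  have hmax : ∀ x : E, v.valuation E x < 1 → v.valuation E (D x) ≤ B * exp (-1) := by
    intro w hw
    obtain ⟨x, rfl⟩ : ∃ x, w = π * x := ⟨w / π, by field_simp⟩
    have hx : v.valuation E x ≤ 1 := by
      by_cases hx0 : x = 0
      · simp [hx0]
      obtain ⟨z, hz⟩ : ∃ z : ℤ, v.valuation E x = exp z :=
        ⟨_, (exp_log (by simpa using hx0)).symm⟩
      rw [map_mul, hπ, hz, ← exp_add, ← exp_zero, exp_lt_exp] at hw
      rw [hz, ← exp_zero, exp_le_exp]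
      omega
    rw [D.leibniz]
    refine (Valuation.map_add _ _ _).trans (max_le ?_ ?_)
    · rw [smul_eq_mul, map_mul, hπ, mul_comm]
      exact mul_le_mul_left (hB' x hx) _
    · rw [smul_eq_mul, map_mul]
      exact (mul_le_of_le_one_left' hx).trans hDπ
  refine ⟨hmax, fun x => ?_⟩
  have hvm := v.isMaximal
  let : Field (O ⧸ v.asIdeal) := Ideal.Quotient.field _
  set y : O ⧸ v.asIdeal := Ideal.Quotient.mk v.asIdeal x with hy
  have hint : IsIntegral K y := (hres.isAlgebraic y).isIntegral
  -- By separability `P'(x)` is a unit while `P(x)` lies in the maximal ideal. So `D x` is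
  -- controlled by `D (P(x))`, which `hmax` bounds, up to an integral error.
  set P := minpoly K y
  have hP0 : aeval x P ∈ v.asIdeal := by
    rw [← Ideal.Quotient.eq_zero_iff_mem, ← Ideal.Quotient.mkₐ_eq_mk K, ← aeval_algHom_apply]
    exact minpoly.aeval K y
  have hP1 : aeval x (derivative P) ∉ v.asIdeal := by
    rw [← Ideal.Quotient.eq_zero_iff_mem, ← Ideal.Quotient.mkₐ_eq_mk K, ← aeval_algHom_apply]
    exact (minpoly.irreducible hint).separable.aeval_derivative_ne_zero (minpoly.aeval K y)
  have e1 := valuation_derivation_aeval_sub_le_one v D hK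
    (v.valuation_le_one (K := E) x) P
  have e2 := hmax (algebraMap O E (aeval x P)) ((v.valuation_lt_one_iff_mem _).2 hP0)
  have e3 : v.valuation E (algebraMap O E (aeval x (derivative P))) = 1 :=
    v.valuation_eq_one_iff_notMem.2 hP1
  rw [← aeval_algebraMap_apply] at e2 e3
  set z := algebraMap O E x
  have e4 : v.valuation E (D z) = v.valuation E
      (D (aeval z P) - (D (aeval z P) - aeval z (derivative P) * D z)) := by
    rw [sub_sub_cancel, map_mul, e3, one_mul]
  rw [e4]
  exact (Valuation.map_sub _ _ _).trans (max_le (e2.trans (le_max_right _ _))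
    (e1.trans (le_max_left _ _)))

/-- A bounded derivation of a discretely valued field of residue characteristic zero preserves the
valuation ring and its maximal ideal, if it kills an element of the maximal ideal and if the residue
field is algebraic over a field that it preserves. -/
theorem valuation_derivation_le_one_and_lt_one (D : Derivation ℤ E E)
    (hK : ∀ a : K, v.valuation E (D (algebraMap K E a)) ≤ 1)
    (hres : Algebra.IsAlgebraic K (O ⧸ v.asIdeal))
    {ε : O} (hε : ε ∈ v.asIdeal) (hε0 : ε ≠ 0) (hDε : D (algebraMap O E ε) = 0)
    {N : ℕ} (hB : ∀ x : O, v.valuation E (D (algebraMap O E x)) ≤ exp (N : ℤ)) :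
    ∀ x : E, (v.valuation E x ≤ 1 → v.valuation E (D x) ≤ 1) ∧
      (v.valuation E x < 1 → v.valuation E (D x) < 1) := by
  have h1 : ∀ x : O, v.valuation E (D (algebraMap O E x)) ≤ 1 := by
    -- Each improvement step divides a bound above 1 by `exp 1`. One further step from the bound 1
    -- gives the strict inequality on the maximal ideal.
    induction N with
    | zero => simpa using hB
    | succ N ih =>
      refine ih fun x => ?_
      refine ((valuation_derivation_improve v D hK hres hε hε0 hDε hB).2 x).trans
        (max_le ?_ ?_)
      · rw [← exp_zero, exp_le_exp]; omega
      · rw [← exp_add, exp_le_exp]; push_cast; omega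
  refine fun x => ⟨valuation_derivation_le_of_integral v D h1, fun hx => ?_⟩
  refine ((valuation_derivation_improve v D hK hres hε hε0 hDε h1).1 x hx).trans_lt ?_
  rw [one_mul, ← exp_zero, exp_lt_exp]
  omega

end Derivations

/-! ### Chevalley's theorem and curve selection -/

section Curves

/-- A dominant morphism of finite type between integral Noetherian affine schemes hits every prime of
a nonempty basic open set. -/
theorem exists_ne_zero_forall_mem_range_comap (A B : Type*) [CommRing A] [IsDomain A]
    [IsNoetherianRing A] [CommRing B] [Algebra A B] [FaithfulSMul A B]
    [Algebra.FiniteType A B] :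
    ∃ f : A, f ≠ 0 ∧ ∀ p : PrimeSpectrum A, f ∉ p.asIdeal →
      p ∈ Set.range (PrimeSpectrum.comap (algebraMap A B)) := by
  have hfp : (algebraMap A B).FinitePresentation :=
    RingHom.finitePresentation_algebraMap.2 (Algebra.FinitePresentation.of_finiteType.1 inferInstance)
  -- By Chevalley the image is constructible. It contains the generic point, and the basic piece
  -- containing that point is a basic open set, because its closed conditions are all `0 = 0`.
  obtain ⟨S, hS⟩ := PrimeSpectrum.exists_constructibleSetData_iff.2
    (PrimeSpectrum.isConstructible_range_comap hfp)
  have h0 : (⟨⊥, Ideal.isPrime_bot⟩ : PrimeSpectrum A) ∈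
      Set.range (PrimeSpectrum.comap (algebraMap A B)) := by
    rw [PrimeSpectrum.mem_range_comap_iff]
    simp only [Ideal.map_bot]
    exact (RingHom.injective_iff_ker_eq_bot _).1 (FaithfulSMul.algebraMap_injective A B)
  rw [← hS] at h0
  simp only [PrimeSpectrum.ConstructibleSetData.toSet, Set.mem_iUnion,
    PrimeSpectrum.BasicConstructibleSetData.toSet] at h0
  obtain ⟨C, hC, hg, hf⟩ := h0
  refine ⟨C.f, fun h => hf (by simp [h]), fun p hp => ?_⟩
  rw [← hS]
  simp only [PrimeSpectrum.ConstructibleSetData.toSet, Set.mem_iUnion,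
    PrimeSpectrum.BasicConstructibleSetData.toSet]
  refine ⟨C, hC, fun x hx => ?_, by simpa using hp⟩
  have : x = 0 := hg hx
  simp [this]

/-- A closed point of a nonempty fibre. -/
theorem exists_finite_field_over_residueField.{u, w} {A : Type u} {B : Type w} [CommRing A] [CommRing B] [Algebra A B]
    [Algebra.FiniteType A B] (p : PrimeSpectrum A)
    (hp : p ∈ Set.range (PrimeSpectrum.comap (algebraMap A B))) :
    ∃ (E : Type (max u w)) (_ : Field E) (_ : Algebra p.asIdeal.ResidueField E)
      (_ : Module.Finite p.asIdeal.ResidueField E) (β : B →+* E),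
      ∀ a : A, β (algebraMap A B a) =
        algebraMap p.asIdeal.ResidueField E (algebraMap A p.asIdeal.ResidueField a) := by
  have : Nontrivial (p.asIdeal.ResidueField ⊗[A] B) :=
    (PrimeSpectrum.nontrivial_iff_mem_rangeComap p).2 hp
  obtain ⟨m, hm⟩ := Ideal.exists_maximal (p.asIdeal.ResidueField ⊗[A] B)
  let : Field ((p.asIdeal.ResidueField ⊗[A] B) ⧸ m) := Ideal.Quotient.field m
  have : Algebra.FiniteType p.asIdeal.ResidueField ((p.asIdeal.ResidueField ⊗[A] B) ⧸ m) :=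
    .of_surjective (Ideal.Quotient.mkₐ _ m) (Ideal.Quotient.mkₐ_surjective _ m)
  refine ⟨(p.asIdeal.ResidueField ⊗[A] B) ⧸ m, inferInstance, inferInstance,
    finite_of_finite_type_of_isJacobsonRing _ _,
    (Ideal.Quotient.mk m).comp (Algebra.TensorProduct.includeRight : B →ₐ[A] _).toRingHom,
    fun a => ?_⟩
  have h : (algebraMap A B a) = (Algebra.ofId A B a) := rfl
  simp only [RingHom.comp_apply, AlgHom.toRingHom_eq_coe, RingHom.coe_coe]
  rw [AlgHom.commutes]
  rfl

/-- The restriction of a polynomial to the line `c + X u`. -/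
noncomputable def restrictLine {K : Type*} [Field K] {s : ℕ} (c u : Fin s → K) :
    MvPolynomial (Fin s) K →ₐ[K] K[X] :=
  MvPolynomial.aeval fun i => C (c i) + C (u i) * X

theorem eval_restrictLine {K : Type*} [Field K] {s : ℕ} (c u : Fin s → K) (t : K)
    (h : MvPolynomial (Fin s) K) :
    (restrictLine c u h).eval t = MvPolynomial.eval (fun i => c i + u i * t) h := by
  have : (Polynomial.aeval t).comp (restrictLine c u) =
      MvPolynomial.aeval (R := K) (fun i => c i + u i * t) := by
    ext i
    simp [restrictLine]
  have := DFunLike.congr_fun this h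
  rw [AlgHom.comp_apply, Polynomial.coe_aeval_eq_eval] at this
  rw [this, MvPolynomial.aeval_eq_eval]

/-- Join `c` to a point where `h` is nonzero and whose `i₀`-th coordinate differs from that of `c`.
-/
theorem exists_restrictLine_ne_zero {K : Type*} [Field K] [Infinite K] {s : ℕ} (c : Fin s → K)
    (i₀ : Fin s) {h : MvPolynomial (Fin s) K} (hh : h ≠ 0) :
    ∃ u : Fin s → K, u i₀ ≠ 0 ∧ restrictLine c u h ≠ 0 := by
  have h1 : h * (MvPolynomial.X i₀ - MvPolynomial.C (c i₀)) ≠ 0 := by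
    refine mul_ne_zero hh fun h0 => ?_
    have := congrArg (MvPolynomial.eval fun _ => c i₀ + 1) h0
    simp at this
  obtain ⟨b, hb⟩ : ∃ b, MvPolynomial.eval b (h * (MvPolynomial.X i₀ - MvPolynomial.C (c i₀))) ≠ 0 := by
    by_contra! H
    exact h1 (MvPolynomial.funext fun b => by rw [H b, map_zero])
  rw [map_mul, mul_ne_zero_iff] at hb
  refine ⟨b - c, by simpa using hb.2, fun h0 => hb.1 ?_⟩
  have := eval_restrictLine c (b - c) 1 h
  rw [h0] at this
  simpa using this.symm

theorem restrictLine_surjective {K : Type*} [Field K] {s : ℕ} (c u : Fin s → K) {i₀ : Fin s}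
    (hu : u i₀ ≠ 0) : Function.Surjective (restrictLine c u) := by
  have hX : restrictLine c u
      (MvPolynomial.C (u i₀)⁻¹ * (MvPolynomial.X i₀ - MvPolynomial.C (c i₀))) = X := by
    simp only [restrictLine, map_mul, map_sub, MvPolynomial.aeval_X, MvPolynomial.algHom_C,
      Polynomial.algebraMap_eq, add_sub_cancel_left]
    rw [← mul_assoc, ← C_mul, inv_mul_cancel₀ hu, C_1, one_mul]
  intro q
  refine ⟨aeval (MvPolynomial.C (u i₀)⁻¹ * (MvPolynomial.X i₀ - MvPolynomial.C (c i₀))) q, ?_⟩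
  rw [← aeval_algHom_apply, hX, aeval_X_left_apply]

/-- Through a rational point `ev` of a positive-dimensional affine variety there is a line, in
suitable Noether coordinates, lifting to a curve through `ev` that avoids `f = 0` generically. -/
theorem exists_prime_curve {K A : Type*} [Field K] [Infinite K] [CommRing A] [IsDomain A]
    [Algebra K A] [Algebra.FiniteType K A] (ev : A →ₐ[K] K) {t : A} (ht : t ≠ 0) (hevt : ev t = 0)
    {f : A} (hf : f ≠ 0) :
    ∃ (P : Ideal A) (_ : P.IsPrime) (j : K[X] →ₐ[K] A ⧸ P), f ∉ P ∧ Function.Injective j ∧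
      (j : K[X] →+* A ⧸ P).IsIntegral ∧ P ≤ RingHom.ker ev ∧
      ∃ y : A, ev y = 0 ∧ j X = Ideal.Quotient.mk P y := by
  obtain ⟨s, g, hginj, hgint⟩ := exists_integral_inj_algHom_of_fg K A
  -- If `s = 0`, then `A` is a field, so `t` is a unit, contradicting `ev t = 0`.
  have i₀ : Fin s := by
    rcases s with _ | s
    · exfalso
      have h0 : (algebraMap K A).IsIntegral := by
        have : (algebraMap K (MvPolynomial (Fin 0) K)).IsIntegral := by
          exact RingHom.isIntegral_of_surjective _ (MvPolynomial.C_surjective _)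
        have := this.trans _ _ hgint
        rwa [AlgHom.toRingHom_eq_coe, AlgHom.comp_algebraMap] at this
      have : Algebra.IsIntegral K A := Algebra.isIntegral_def.2 h0
      have hA : IsField A := isField_of_isIntegral_of_isField' (Field.toIsField K)
      obtain ⟨b, hb⟩ := hA.mul_inv_cancel ht
      have := congrArg ev hb
      simp [hevt] at this
    · exact 0
  let c : Fin s → K := fun i => ev (g (MvPolynomial.X i))
  let : Algebra (MvPolynomial (Fin s) K) A := g.toRingHom.toAlgebra
  have halg : ∀ x, algebraMap (MvPolynomial (Fin s) K) A x = g x := fun _ => rfl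
  have : Algebra.IsIntegral (MvPolynomial (Fin s) K) A := Algebra.isIntegral_def.2 hgint
  have : FaithfulSMul (MvPolynomial (Fin s) K) A :=
    (faithfulSMul_iff_algebraMap_injective _ _).2 hginj
  -- A line on which this multiple of `f` is not identically zero keeps `f` out of `P`.
  obtain ⟨h, hh0, hhf⟩ : ∃ h : MvPolynomial (Fin s) K, h ≠ 0 ∧ g h ∈ Ideal.span {f} := by
    have := Ideal.comap_ne_bot_of_integral_mem (R := MvPolynomial (Fin s) K) hf
      (Ideal.mem_span_singleton_self f) (Algebra.IsIntegral.isIntegral f)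
    obtain ⟨h, hh, h0⟩ := Submodule.exists_mem_ne_zero_of_ne_bot this
    exact ⟨h, h0, hh⟩
  obtain ⟨u, hu, hul⟩ := exists_restrictLine_ne_zero c i₀ hh0
  have hsurj := restrictLine_surjective c u hu
  have hev : ∀ x, ev (g x) = (restrictLine c u x).eval 0 := by
    intro x
    rw [eval_restrictLine, ← MvPolynomial.aeval_eq_eval]
    have : ev.comp g = MvPolynomial.aeval (R := K) (fun i => c i + u i * 0) := by
      ext i; simp [c]
    exact DFunLike.congr_fun this x
  let l : Ideal (MvPolynomial (Fin s) K) := RingHom.ker (restrictLine c u)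
  have : l.IsPrime := RingHom.ker_isPrime _
  have : (RingHom.ker ev).IsPrime := RingHom.ker_isPrime _
  -- Going down: the line passes through the image `c` of the point `ev`, so its ideal lifts to a
  -- prime below `ker ev`.
  obtain ⟨P, hPle, hPprime, hPl⟩ := Ideal.exists_ideal_le_liesOver_of_le
    (p := l) (q := (RingHom.ker ev).under (MvPolynomial (Fin s) K)) (RingHom.ker ev) (by
      intro x hx
      rw [Ideal.mem_comap, RingHom.mem_ker, halg, hev, (RingHom.mem_ker.1 hx), eval_zero])
  have hP : ∀ x, g x ∈ P ↔ restrictLine c u x = 0 := by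
    intro x
    rw [← RingHom.mem_ker, ← halg, ← Ideal.mem_comap]
    exact (SetLike.ext_iff.1 hPl.over x).symm
  let j : K[X] →ₐ[K] A ⧸ P := AlgHom.liftOfSurjective (restrictLine c u) hsurj
    ((Ideal.Quotient.mkₐ K P).comp g) (by
      intro x hx
      change Ideal.Quotient.mkₐ K P (g x) = 0
      rw [Ideal.Quotient.mkₐ_eq_mk,
        Ideal.Quotient.eq_zero_iff_mem]
      exact (hP x).2 hx)
  have hj : ∀ x, j (restrictLine c u x) = Ideal.Quotient.mk P (g x) := fun x => by
    simp [j]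
  refine ⟨P, hPprime, j, ?_, ?_, ?_, hPle, ?_⟩
  · intro hfP
    exact hul ((hP h).1 ((Ideal.span_singleton_le_iff_mem P).2 hfP hhf))
  · rw [injective_iff_map_eq_zero]
    intro q hq
    obtain ⟨x, rfl⟩ := hsurj q
    rw [hj, Ideal.Quotient.eq_zero_iff_mem] at hq
    exact (hP x).1 hq
  · refine RingHom.IsIntegral.tower_top (restrictLine c u).toRingHom _ ?_
    have : (j : K[X] →+* A ⧸ P).comp (restrictLine c u).toRingHom =
        (Ideal.Quotient.mk P).comp g.toRingHom := RingHom.ext hj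
    rw [this]
    exact hgint.trans _ _ (RingHom.isIntegral_of_surjective _ Ideal.Quotient.mk_surjective)
  · obtain ⟨x, hx⟩ := hsurj X
    exact ⟨g x, by rw [hev, hx, eval_X], by rw [← hx, hj]⟩

/-- Curve selection: a rational point `ev` of an affine variety `Spec A` is the centre of a place of
a one-dimensional function field `E` lifting along a dominant morphism `Spec B → Spec A`. -/
theorem exists_place.{u, w} {K : Type*} {A : Type u} {B : Type w} [Field K] [Infinite K] [CommRing A] [IsDomain A]
    [CommRing B] [Algebra K A] [Algebra K B] [Algebra A B] [IsScalarTower K A B]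
    [FaithfulSMul A B] [Algebra.FiniteType K A] [Algebra.FiniteType K B]
    (ev : A →ₐ[K] K) {t : A} (ht : t ≠ 0) (hevt : ev t = 0) :
    ∃ (E : Type (max u w)) (_ : Field E) (_ : Algebra K[X] E) (_ : FaithfulSMul K[X] E)
      (_ : Algebra.IsAlgebraic K[X] E) (_ : Algebra.EssFiniteType K[X] E)
      (β : B →+* E) (M : Ideal (integralClosure K[X] E)),
      (∀ a : K, β (algebraMap K B a) = algebraMap K[X] E (C a)) ∧ M.IsPrime ∧
      algebraMap K[X] (integralClosure K[X] E) X ∈ M ∧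
      ∀ a : A, ev a = 0 → ∃ w ∈ M, β (algebraMap A B a) = w := by
  have : IsNoetherianRing A := Algebra.FiniteType.isNoetherianRing K A
  have : Algebra.FiniteType A B := Algebra.FiniteType.of_restrictScalars_finiteType K A B
  obtain ⟨f, hf, hrange⟩ := exists_ne_zero_forall_mem_range_comap A B
  obtain ⟨P, hPprime, j, hfP, hjinj, hjint, hPev, y, hevy, hjy⟩ := exists_prime_curve ev ht hevt hf
  obtain ⟨E, _, _, _, β, hβ⟩ := exists_finite_field_over_residueField ⟨P, hPprime⟩
    (hrange ⟨P, hPprime⟩ hfP)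
  simp only at *
  let : Algebra (A ⧸ P) E := ((algebraMap P.ResidueField E).comp
    (algebraMap (A ⧸ P) P.ResidueField)).toAlgebra
  have : IsScalarTower (A ⧸ P) P.ResidueField E := .of_algebraMap_eq' rfl
  let : Algebra K[X] (A ⧸ P) := j.toRingHom.toAlgebra
  let : Algebra K[X] E := ((algebraMap (A ⧸ P) E).comp (algebraMap K[X] (A ⧸ P))).toAlgebra
  have : IsScalarTower K[X] (A ⧸ P) E := .of_algebraMap_eq' rfl
  let : Algebra K E := ((algebraMap K[X] E).comp (algebraMap K K[X])).toAlgebra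
  have : IsScalarTower K K[X] E := .of_algebraMap_eq' rfl
  have : IsScalarTower K (A ⧸ P) E := .of_algebraMap_eq fun a => by
    change algebraMap (A ⧸ P) E (j (algebraMap K K[X] a)) = _
    rw [AlgHom.commutes]
  have hAE : Function.Injective (algebraMap (A ⧸ P) E) := by
    rw [IsScalarTower.algebraMap_eq (A ⧸ P) P.ResidueField E]
    exact (algebraMap P.ResidueField E).injective.comp (IsFractionRing.injective _ _)
  have hinj : Function.Injective (algebraMap K[X] E) := hAE.comp hjinj
  have : FaithfulSMul K[X] E := (faithfulSMul_iff_algebraMap_injective _ _).2 hinj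
  have : Algebra.IsIntegral K[X] (A ⧸ P) := Algebra.isIntegral_def.2 hjint
  have : FaithfulSMul K[X] (A ⧸ P) := (faithfulSMul_iff_algebraMap_injective _ _).2 hjinj
  have : FaithfulSMul (A ⧸ P) E := (faithfulSMul_iff_algebraMap_injective _ _).2 hAE
  have : Algebra.IsAlgebraic P.ResidueField E := Algebra.IsAlgebraic.of_finite _ _
  have : Algebra.IsAlgebraic (A ⧸ P) E :=
    (IsFractionRing.comap_isAlgebraic_iff (K := P.ResidueField)).2 inferInstance
  have : Algebra.IsAlgebraic K[X] E := Algebra.IsAlgebraic.trans K[X] (A ⧸ P) E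
  have : Algebra.EssFiniteType (A ⧸ P) P.ResidueField :=
    Algebra.EssFiniteType.of_comp A (A ⧸ P) P.ResidueField
  have : Algebra.EssFiniteType (A ⧸ P) E := .comp _ P.ResidueField _
  have : Algebra.EssFiniteType K E := .comp _ (A ⧸ P) _
  have : Algebra.EssFiniteType K[X] E := .of_comp K _ _
  let γ : A ⧸ P →ₐ[K[X]] integralClosure K[X] E := IsIntegralClosure.lift K[X] _ E
  have hγ : ∀ a, (γ a : E) = algebraMap (A ⧸ P) E a :=
    fun a => IsIntegralClosure.algebraMap_lift K[X] (integralClosure K[X] E) E a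
  have hγint : γ.toRingHom.IsIntegral := by
    refine RingHom.IsIntegral.tower_top (algebraMap K[X] (A ⧸ P)) _ ?_
    rw [AlgHom.toRingHom_eq_coe, AlgHom.comp_algebraMap]
    exact Algebra.isIntegral_def.1 inferInstance
  let evP : A ⧸ P →+* K := Ideal.Quotient.lift P ev.toRingHom fun a ha => hPev ha
  have hevP : ∀ a, evP (Ideal.Quotient.mk P a) = ev a := fun a => rfl
  let : Algebra (A ⧸ P) (integralClosure K[X] E) := γ.toRingHom.toAlgebra
  have : Algebra.IsIntegral (A ⧸ P) (integralClosure K[X] E) := Algebra.isIntegral_def.2 hγint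
  have : (RingHom.ker evP).IsPrime := RingHom.ker_isPrime _
  -- Lying over: the point `ev` of the curve lifts to its normalization in `E`.
  obtain ⟨M, hM, hMc⟩ := Ideal.exists_ideal_over_prime_of_isIntegral_of_isDomain
    (S := integralClosure K[X] E) (RingHom.ker evP) (by
      intro a ha
      have : algebraMap (A ⧸ P) E a = 0 := by
        rw [← hγ, show γ a = 0 from ha]; rfl
      rw [(injective_iff_map_eq_zero _).1 hAE a this]
      exact Ideal.zero_mem _)
  have hmem : ∀ a, ev a = 0 → γ (Ideal.Quotient.mk P a) ∈ M := by
    intro a ha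
    have : Ideal.Quotient.mk P a ∈ M.comap (algebraMap (A ⧸ P) (integralClosure K[X] E)) := by
      rw [hMc, RingHom.mem_ker, hevP, ha]
    exact this
  have hβ' : ∀ a : A, β (algebraMap A B a) = algebraMap (A ⧸ P) E (Ideal.Quotient.mk P a) := by
    intro a
    rw [hβ]
    rfl
  refine ⟨E, inferInstance, inferInstance, inferInstance, inferInstance, inferInstance, β, M,
    fun a => ?_, hM, ?_, fun a ha => ⟨_, hmem a ha, ?_⟩⟩
  · rw [IsScalarTower.algebraMap_apply K A B, hβ']
    change _ = algebraMap K E a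
    rw [IsScalarTower.algebraMap_apply K (A ⧸ P) E]
    rfl
  · have : algebraMap K[X] (integralClosure K[X] E) X = γ (Ideal.Quotient.mk P y) := by
      rw [← hjy]
      exact (γ.commutes X).symm
    rw [this]
    exact hmem y hevy
  · rw [hβ', hγ]

end Curves

/-! ### Places compatible with derivations -/

section DifferentialPlaces

open WithZero IsDedekindDomain

theorem exists_nat_forall_finset_le_exp {α : Type*} (S : Finset α) (f : α → ℤᵐ⁰) :
    ∃ N : ℕ, ∀ x ∈ S, f x ≤ exp (N : ℤ) := by
  classical
  induction S using Finset.induction_on with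
  | empty => exact ⟨0, by simp⟩
  | insert a S _ ih =>
    obtain ⟨N, hN⟩ := ih
    obtain ⟨n, hn⟩ : ∃ n : ℕ, f a ≤ exp (n : ℤ) := by
      by_cases h0 : f a = 0
      · exact ⟨0, by simp [h0]⟩
      · refine ⟨(log (f a)).toNat, ?_⟩
        rw [← exp_log h0, exp_le_exp, log_exp]
        exact Int.self_le_toNat _
    refine ⟨max n N, fun x hx => ?_⟩
    rcases Finset.mem_insert.1 hx with rfl | hx
    · exact hn.trans (exp_le_exp.2 (by push_cast; exact le_max_left _ _))
    · exact (hN x hx).trans (exp_le_exp.2 (by push_cast; exact le_max_right _ _))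

/-- A place of a function field in one variable, compatible with the derivations of the constants. -/
theorem exists_differential_place_of_ne_zero.{u, w} {K : Type*} {A : Type u} {B : Type w} [Field K]
    [CharZero K] [CommRing A] [IsDomain A] [CommRing B] [Algebra K A] [Algebra K B] [Algebra A B]
    [IsScalarTower K A B] [FaithfulSMul A B] [Algebra.FiniteType K A] [Algebra.FiniteType K B]
    (ev : A →ₐ[K] K) {t : A} (ht : t ≠ 0) (hevt : ev t = 0) :
    ∃ (E : Type (max u w)) (_ : Field E) (_ : Algebra K E) (β : B →ₐ[K] E) (v : Valuation E ℤᵐ⁰),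
      (∀ a : K, a ≠ 0 → v (algebraMap K E a) = 1) ∧
      (∀ a : A, ev a = 0 → v (β (algebraMap A B a)) < 1) ∧
      ∀ D : Derivation ℤ K K, ∃ D' : Derivation ℤ E E,
        (∀ a, D' (algebraMap K E a) = algebraMap K E (D a)) ∧
        ∀ x, (v x ≤ 1 → v (D' x) ≤ 1) ∧ (v x < 1 → v (D' x) < 1) := by
  obtain ⟨E, _, _, _, _, _, β, M, hβK, hM, hXM, hβA⟩ := exists_place (B := B) ev ht hevt
  let : Algebra K E := ((algebraMap K[X] E).comp C).toAlgebra
  have : IsScalarTower K K[X] E := .of_algebraMap_eq' rfl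
  let : Algebra (FractionRing K[X]) E := FractionRing.liftAlgebra K[X] E
  have : IsScalarTower K[X] (FractionRing K[X]) E := FractionRing.isScalarTower_liftAlgebra _ _
  have : Algebra.IsAlgebraic (FractionRing K[X]) E :=
    (IsFractionRing.comap_isAlgebraic_iff (A := K[X])).1 inferInstance
  have : Algebra.EssFiniteType (FractionRing K[X]) E := .of_comp K[X] _ _
  have : Module.Finite (FractionRing K[X]) E := Algebra.finite_of_essFiniteType_of_isAlgebraic
  have : CharZero (FractionRing K[X]) :=
    charZero_of_injective_algebraMap (R := K[X]) (IsFractionRing.injective _ _)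
  let O := integralClosure K[X] E
  have : IsDedekindDomain O := integralClosure.isDedekindDomain K[X] (FractionRing K[X]) E
  have : IsFractionRing O E :=
    integralClosure.isFractionRing_of_finite_extension (FractionRing K[X]) E
  have : Module.Finite K[X] O := IsIntegralClosure.finite K[X] (FractionRing K[X]) E O
  have hX0 : algebraMap K[X] O X ≠ 0 := by
    intro h
    have : algebraMap K[X] E X = 0 := by
      rw [IsScalarTower.algebraMap_apply K[X] O E, h, map_zero]
    exact X_ne_zero ((FaithfulSMul.algebraMap_injective K[X] E) (by rw [this, map_zero]))
  let v : HeightOneSpectrum O := ⟨M, hM, fun h => hX0 (by rw [h] at hXM; exact hXM)⟩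
  let : Algebra K O := ((algebraMap K[X] O).comp C).toAlgebra
  have : IsScalarTower K K[X] O := .of_algebraMap_eq' rfl
  have : IsScalarTower K O E := .of_algebraMap_eq fun a => by
    rw [IsScalarTower.algebraMap_apply K K[X] E, IsScalarTower.algebraMap_apply K[X] O E]
    rfl
  refine ⟨E, inferInstance, inferInstance, ⟨β, hβK⟩, v.valuation E,
    fun a ha => valuation_algebraMap_field_eq_one v ha, fun a ha => ?_, fun D => ?_⟩
  · obtain ⟨w, hw, h⟩ := hβA a ha
    change v.valuation E (β (algebraMap A B a)) < 1
    rw [h]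
    exact (v.valuation_lt_one_iff_mem w).2 hw
  · obtain ⟨D', hD', hDX, hDp⟩ := exists_derivation_extension_polynomial (E := E) D
    have hvp : ∀ p : K[X], v.valuation E (algebraMap K[X] E p) ≤ 1 := fun p => by
      rw [IsScalarTower.algebraMap_apply K[X] O E]
      exact v.valuation_le_one _
    -- `O` is finite over `K[X]` and `D'` maps `K[X]` into itself, so a bound on generators bounds
    -- `D'` on `O`.
    obtain ⟨S, hS⟩ := (Module.Finite.fg_top : (⊤ : Submodule K[X] O).FG)
    obtain ⟨N, hN⟩ := exists_nat_forall_finset_le_exp S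
      fun x => v.valuation E (D' (algebraMap O E x))
    have h1N : (1 : ℤᵐ⁰) ≤ exp (N : ℤ) := by
      rw [← exp_zero, exp_le_exp]; omega
    refine ⟨D', hD', valuation_derivation_le_one_and_lt_one (K := K) v D' (fun a => ?_) ?_ hXM hX0
      ?_ (N := N) fun x => ?_⟩
    · rw [hD']
      exact valuation_algebraMap_field_le_one v _
    · have h : (algebraMap K[X] (O ⧸ v.asIdeal)).IsIntegral :=
        Algebra.isIntegral_def.1 inferInstance
      -- As `X ∈ M`, scalars from `K[X]` act on the residue field through their value at 0, so it is
      -- integral over `K`.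
      have h2 : algebraMap K[X] (O ⧸ v.asIdeal) =
          (algebraMap K (O ⧸ v.asIdeal)).comp (evalRingHom 0) := by
        refine Polynomial.ringHom_ext (fun a => ?_) ?_
        · rw [RingHom.comp_apply, coe_evalRingHom, eval_C]
          rfl
        · rw [RingHom.comp_apply, coe_evalRingHom, eval_X, map_zero]
          exact Ideal.Quotient.eq_zero_iff_mem.2 hXM
      rw [h2] at h
      have := Algebra.isIntegral_def.2 (h.tower_top)
      have : Nontrivial (O ⧸ v.asIdeal) := Ideal.Quotient.nontrivial_iff.2 hM.ne_top
      infer_instance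
    · rw [← IsScalarTower.algebraMap_apply K[X] O E]
      exact hDX
    · have hx : x ∈ Submodule.span K[X] (S : Set O) := by rw [hS]; trivial
      induction hx using Submodule.span_induction with
      | mem x hx => exact hN x hx
      | zero => simp
      | add x y _ _ hx hy =>
        rw [map_add, map_add]
        exact (Valuation.map_add _ _ _).trans (max_le hx hy)
      | smul p x _ hx =>
        obtain ⟨q, hq⟩ := hDp p
        rw [Algebra.smul_def, map_mul, ← IsScalarTower.algebraMap_apply K[X] O E, D'.leibniz, hq]
        refine (Valuation.map_add _ _ _).trans (max_le ?_ ?_)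
        · rw [smul_eq_mul, map_mul]
          exact (mul_le_of_le_one_left' (hvp p)).trans hx
        · rw [smul_eq_mul, map_mul]
          exact (mul_le_one' (v.valuation_le_one x) (hvp q)).trans h1N

/-- Adjoining a variable to `A` and `B` supplies the nonzero element vanishing at the point, even if
`A` is a field. -/
theorem exists_differential_place.{u, w} {K : Type*} {A : Type u} {B : Type w} [Field K]
    [CharZero K] [CommRing A] [CommRing B] [IsDomain B] [Algebra K A] [Algebra K B]
    [Algebra.FiniteType K A] [Algebra.FiniteType K B] (ι : A →ₐ[K] B) (hι : Function.Injective ι)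
    (ev : A →ₐ[K] K) :
    ∃ (E : Type (max u w)) (_ : Field E) (_ : Algebra K E) (β : B →ₐ[K] E) (v : Valuation E ℤᵐ⁰),
      (∀ a : K, a ≠ 0 → v (algebraMap K E a) = 1) ∧
      (∀ a : A, ev a = 0 → v (β (ι a)) < 1) ∧
      ∀ D : Derivation ℤ K K, ∃ D' : Derivation ℤ E E,
        (∀ a, D' (algebraMap K E a) = algebraMap K E (D a)) ∧
        ∀ x, (v x ≤ 1 → v (D' x) ≤ 1) ∧ (v x < 1 → v (D' x) < 1) := by
  have : IsDomain A := hι.isDomain ι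
  let : Algebra A[X] B[X] := (mapRingHom ι.toRingHom).toAlgebra
  have halg : ∀ p : A[X], algebraMap A[X] B[X] p = p.map ι.toRingHom := fun _ => rfl
  have : IsScalarTower K A[X] B[X] := .of_algebraMap_eq fun a => by
    rw [halg, Polynomial.algebraMap_apply, Polynomial.algebraMap_apply, map_C]
    congr 1
    exact (ι.commutes a).symm
  have : FaithfulSMul A[X] B[X] :=
    (faithfulSMul_iff_algebraMap_injective _ _).2 (map_injective _ hι)
  have : Algebra.FiniteType K A[X] := .trans (S := A) inferInstance inferInstance
  have : Algebra.FiniteType K B[X] := .trans (S := B) inferInstance inferInstance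
  let ev' : A[X] →ₐ[K] K := ev.comp ((Polynomial.aeval (R := A) (0 : A)).restrictScalars K)
  obtain ⟨E, _, _, β, v, h1, h2, h3⟩ := exists_differential_place_of_ne_zero (B := B[X]) ev'
    (t := X) X_ne_zero (by simp [ev'])
  refine ⟨E, inferInstance, inferInstance, β.comp (IsScalarTower.toAlgHom K B B[X]), v, h1,
    fun a ha => ?_, h3⟩
  have := h2 (C a) (by simpa [ev'] using ha)
  rw [halg, map_C] at this
  exact this

/-- Base change to `K` turns the `K`-valued point `ev` into a rational point. -/
theorem exists_differential_place_baseChange.{u} {F : Type*} {K A B : Type u} [Field F] [Field K]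
    [CharZero K] [Algebra F K] [CommRing A] [CommRing B] [Algebra F A] [Algebra F B]
    [Algebra.FiniteType F A] [Algebra.FiniteType F B] [IsDomain (K ⊗[F] B)] (ι : A →ₐ[F] B)
    (hι : Function.Injective ι) (ev : A →ₐ[F] K) :
    ∃ (E : Type u) (_ : Field E) (_ : Algebra K E) (_ : Algebra F E) (_ : IsScalarTower F K E)
      (β : B →ₐ[F] E) (v : Valuation E ℤᵐ⁰),
      (∀ a : K, a ≠ 0 → v (algebraMap K E a) = 1) ∧
      (∀ a : A, v (β (ι a) - algebraMap K E (ev a)) < 1) ∧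
      ∀ D : Derivation ℤ K K, ∃ D' : Derivation ℤ E E,
        (∀ a, D' (algebraMap K E a) = algebraMap K E (D a)) ∧
        ∀ x, (v x ≤ 1 → v (D' x) ≤ 1) ∧ (v x < 1 → v (D' x) < 1) := by
  let ιK : (K ⊗[F] A) →ₐ[K] K ⊗[F] B := Algebra.TensorProduct.map (AlgHom.id K K) ι
  have hιK : Function.Injective ιK :=
    Module.Flat.lTensor_preserves_injective_linearMap (M := K) ι.toLinearMap hι
  let evK : (K ⊗[F] A) →ₐ[K] K :=
    Algebra.TensorProduct.lift (AlgHom.id K K) ev fun _ _ => Commute.all _ _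
  obtain ⟨E, _, _, β, v, h1, h2, h3⟩ := exists_differential_place ιK hιK evK
  let : Algebra F E := ((algebraMap K E).comp (algebraMap F K)).toAlgebra
  have : IsScalarTower F K E := .of_algebraMap_eq' rfl
  refine ⟨E, inferInstance, inferInstance, inferInstance, inferInstance,
    (β.restrictScalars F).comp Algebra.TensorProduct.includeRight, v, h1, fun a => ?_, h3⟩
  have h4 := h2 (1 ⊗ₜ a - algebraMap K _ (ev a)) (by
    rw [map_sub, AlgHom.commutes, Algebra.TensorProduct.lift_tmul]
    simp)
  rw [map_sub, map_sub, AlgHom.commutes, AlgHom.commutes] at h4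
  have h5 : ιK (1 ⊗ₜ a) = 1 ⊗ₜ ι a := by simp [ιK]
  rw [h5] at h4
  exact h4

/-- A point `p` in the closure of the image of a polynomial map `g` is the specialization of a point
in the image, by a place compatible with derivations. -/
theorem exists_differential_lift.{u} {F K : Type u} [Field F] [Field K] [CharZero K] [Algebra F K]
    {σ ι : Type} [Finite σ] [Finite ι] (g : ι → MvPolynomial σ F) (p : ι → K)
    (h : ∀ P : MvPolynomial ι F, MvPolynomial.aeval g P = 0 → MvPolynomial.aeval p P = 0) :
    ∃ (E : Type u) (_ : Field E) (_ : Algebra K E) (_ : Algebra F E) (_ : IsScalarTower F K E)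
      (z : σ → E) (v : Valuation E ℤᵐ⁰),
      (∀ a : K, a ≠ 0 → v (algebraMap K E a) = 1) ∧
      (∀ i, v (MvPolynomial.aeval z (g i) - algebraMap K E (p i)) < 1) ∧
      ∀ D : Derivation ℤ K K, ∃ D' : Derivation ℤ E E,
        (∀ a, D' (algebraMap K E a) = algebraMap K E (D a)) ∧
        ∀ x, (v x ≤ 1 → v (D' x) ≤ 1) ∧ (v x < 1 → v (D' x) < 1) := by
  -- The quotient by `J` is the coordinate ring of the closure of the image of `g`; by `h`, `p` is a
  -- `K`-point of it.
  let J : Ideal (MvPolynomial ι F) := RingHom.ker (MvPolynomial.aeval (R := F) g)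
  let ι₀ : (MvPolynomial ι F ⧸ J) →ₐ[F] MvPolynomial σ F :=
    Ideal.kerLiftAlg (MvPolynomial.aeval (R := F) g)
  have hι₀ : Function.Injective ι₀ := Ideal.kerLiftAlg_injective _
  let ev₀ : (MvPolynomial ι F ⧸ J) →ₐ[F] K :=
    Ideal.Quotient.liftₐ J (MvPolynomial.aeval p) fun P hP => h P hP
  have : IsDomain (K ⊗[F] MvPolynomial σ F) :=
    (MvPolynomial.algebraTensorAlgEquiv (σ := σ) F K).toMulEquiv.isDomain _
  obtain ⟨E, _, _, _, _, β, v, h1, h2, h3⟩ :=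
    exists_differential_place_baseChange (K := K) ι₀ hι₀ ev₀
  refine ⟨E, inferInstance, inferInstance, inferInstance, inferInstance,
    fun s => β (MvPolynomial.X s), v, h1, fun i => ?_, h3⟩
  have hβ : MvPolynomial.aeval (R := F) (fun s => β (MvPolynomial.X s)) = β := by
    ext; simp
  rw [hβ]
  have h4 := h2 (Ideal.Quotient.mk J (MvPolynomial.X i))
  have h5 : ι₀ (Ideal.Quotient.mk J (MvPolynomial.X i)) = g i := by
    change MvPolynomial.aeval g (MvPolynomial.X i) = _
    simp
  have h6 : ev₀ (Ideal.Quotient.mk J (MvPolynomial.X i)) = p i := by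
    change MvPolynomial.aeval p (MvPolynomial.X i) = _
    simp
  rwa [h5, h6] at h4

end DifferentialPlaces

/-! ### Leibniz rule for compositions of derivations -/

section IteratedDerivations

variable {E : Type*} [Field E]

/-- The composition `D 0 ∘ D 1 ∘ ⋯` of those derivations `D l` for which `q l` is true. -/
noncomputable def iterDer : {d : ℕ} → (Fin d → Derivation ℤ E E) → (Fin d → Bool) → E →ₗ[ℤ] E
  | 0, _, _ => LinearMap.id
  | _ + 1, D, q =>
    if q 0 then (D 0).toLinearMap ∘ₗ iterDer (fun l => D l.succ) (fun l => q l.succ)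
    else iterDer (fun l => D l.succ) (fun l => q l.succ)

theorem iterDer_congr {d : ℕ} {D D' : Fin d → Derivation ℤ E E} {q : Fin d → Bool}
    (h : ∀ l, q l = true → D l = D' l) : iterDer D q = iterDer D' q := by
  induction d with
  | zero => rfl
  | succ d ih =>
    simp only [iterDer]
    rw [ih fun l hl => h l.succ hl]
    split_ifs with h0
    · rw [h 0 h0]
    · rfl

theorem derivation_prod {ι : Type*} [DecidableEq ι] (D : Derivation ℤ E E) (s : Finset ι)
    (a : ι → E) :
    D (∏ j ∈ s, a j) = ∑ i ∈ s, ∏ j ∈ s, if i = j then D (a j) else a j := by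
  induction s using Finset.induction_on with
  | empty => simp
  | insert x s hx ih =>
    rw [Finset.prod_insert hx, D.leibniz, ih, Finset.sum_insert hx, Finset.prod_insert hx]
    simp only [smul_eq_mul, if_true]
    rw [add_comm, mul_comm (D (a x))]
    congr 1
    · congr 1
      refine Finset.prod_congr rfl fun j hj => ?_
      rw [if_neg]
      rintro rfl
      exact hx hj
    · rw [Finset.mul_sum]
      refine Finset.sum_congr rfl fun i hi => ?_
      rw [Finset.prod_insert hx, if_neg]
      rintro rfl
      exact hx hi

/-- `f l` records which factor `D l` hits; this is the source of the factor `k ^ d`. -/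
theorem iterDer_prod {d k : ℕ} (D : Fin d → Derivation ℤ E E) (a : Fin k → E) :
    iterDer D (fun _ => true) (∏ j, a j) =
      ∑ f : Fin d → Fin k, ∏ j, iterDer D (fun l => decide (f l = j)) (a j) := by
  induction d with
  | zero => simp [iterDer]
  | succ d ih =>
    have h1 : iterDer D (fun _ => true) (∏ j, a j) =
        D 0 (iterDer (fun l => D l.succ) (fun _ => true) (∏ j, a j)) := by simp [iterDer]
    rw [h1, ih, map_sum, ← (Fin.consEquiv fun _ => Fin k).sum_comp, Fintype.sum_prod_type,
      Finset.sum_comm]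
    refine Finset.sum_congr rfl fun f _ => ?_
    rw [derivation_prod]
    refine Finset.sum_congr rfl fun i _ => Finset.prod_congr rfl fun j _ => ?_
    by_cases hij : i = j <;> simp [iterDer, Fin.consEquiv, hij]

theorem iterDer_const_mul {d : ℕ} {D : Fin d → Derivation ℤ E E} {q : Fin d → Bool} {a : E}
    (ha : ∀ l, D l a = 0) (b : E) : iterDer D q (a * b) = a * iterDer D q b := by
  induction d with
  | zero => rfl
  | succ d ih =>
    simp only [iterDer]
    split_ifs with h0
    · simp [ih fun l => ha l.succ, ha 0]
    · exact ih fun l => ha l.succ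

/-- Taking the `c l` in `ℕ` makes them constants for every derivation. -/
theorem iterDer_prod_dual {d : ℕ} {D : Fin d → Derivation ℤ E E} {y : Fin d → E} {c : Fin d → ℕ}
    (h : ∀ l l', D l (y l') = if l = l' then (c l : E) else 0) :
    iterDer D (fun _ => true) (∏ l, y l) = ∏ l, (c l : E) := by
  induction d with
  | zero => simp [iterDer]
  | succ d ih =>
    simp only [iterDer, if_true, LinearMap.comp_apply]
    rw [Fin.prod_univ_succ, Fin.prod_univ_succ, iterDer_const_mul fun l => by
      rw [h, if_neg (Fin.succ_ne_zero l)], ih (c := fun l => c l.succ) fun l l' => by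
      rw [h]; simp]
    change D 0 (y 0 * _) = _
    rw [D 0 |>.leibniz, h, if_pos rfl, ← Nat.cast_prod, Derivation.map_natCast]
    simp [mul_comm]

theorem valuation_iterDer_lt_one {Γ : Type*} [LinearOrderedCommGroupWithZero Γ]
    {v : Valuation E Γ} {d : ℕ} {D : Fin d → Derivation ℤ E E} {q : Fin d → Bool}
    (h : ∀ l x, v x < 1 → v (D l x) < 1) {x : E} (hx : v x < 1) : v (iterDer D q x) < 1 := by
  induction d with
  | zero => exact hx
  | succ d ih =>
    simp only [iterDer]
    split_ifs with h0
    · exact h 0 _ (ih fun l => h l.succ)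
    · exact ih fun l => h l.succ

end IteratedDerivations

/-! ### Tensor rank in coordinates -/

section Coordinates

/-- The coordinate tensor `t` is a sum of `R` products. -/
def CoordRankLE {E : Type*} [Field E] {k m : ℕ} (R : ℕ) (t : (Fin k → Fin m) → E) : Prop :=
  ∃ b : Fin R → Fin k → Fin m → E, ∀ c, t c = ∑ i, ∏ j, b i j (c j)

variable {E : Type*} [Field E] {k m : ℕ}

/-- Missing terms are padded by zero vectors; this needs `1 ≤ k`, since an empty product is 1. -/
theorem CoordRankLE.of_fintype (hk : 1 ≤ k) {S : Type*} [Fintype S] {R : ℕ}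
    (hS : Fintype.card S ≤ R) {t : (Fin k → Fin m) → E} (b : S → Fin k → Fin m → E)
    (h : ∀ c, t c = ∑ s, ∏ j, b s j (c j)) : CoordRankLE R t := by
  obtain ⟨e⟩ : Nonempty (S ↪ Fin R) :=
    Function.Embedding.nonempty_of_card_le (by simpa using hS)
  refine ⟨Function.extend e b 0, fun c => ?_⟩
  rw [h, ← Finset.sum_subset (Finset.subset_univ (Finset.univ.map e)), Finset.sum_map]
  · simp [e.injective.extend_apply]
  · intro i _ hi
    rw [Function.extend_apply' _ _ _ (by simpa using hi)]
    exact Finset.prod_eq_zero (Finset.mem_univ ⟨0, hk⟩) rfl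

theorem CoordRankLE.sum (hk : 1 ≤ k) {S : Type*} [Fintype S] {R : ℕ}
    {t : S → (Fin k → Fin m) → E} (h : ∀ s, CoordRankLE R (t s)) :
    CoordRankLE (Fintype.card S * R) (fun c => ∑ s, t s c) := by
  choose b hb using h
  refine .of_fintype hk (S := S × Fin R) (by simp) (fun x => b x.1 x.2) fun c => ?_
  rw [Fintype.sum_prod_type]
  exact Finset.sum_congr rfl fun s _ => hb s c

theorem exists_large_fiber {d k : ℕ} (hk : 1 ≤ k) (f : Fin d → Fin k) :
    ∃ j, d ≤ k * Fintype.card {l // f l = j} := by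
  by_contra! H
  have : Nonempty (Fin k) := ⟨⟨0, hk⟩⟩
  have h1 : ∑ j : Fin k, k * Fintype.card {l // f l = j} < ∑ _j : Fin k, d :=
    Finset.sum_lt_sum_of_nonempty Finset.univ_nonempty fun j _ => H j
  rw [← Finset.mul_sum, ← Fintype.card_sigma, Fintype.card_congr (Equiv.sigmaFiberEquiv f)] at h1
  simp at h1

/-- A tensor obtained by contracting `T` with a product of `k` multilinear forms, where the
`j`-th one involves the slots `l` with `f l = j`. -/
theorem CoordRankLE.contraction {n d : ℕ} (hk : 1 ≤ k) (f : Fin d → Fin k)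
    (β : Fin k → (Fin d → Fin n) → Fin m → E)
    (hβ : ∀ j J J', (∀ l, f l = j → J l = J' l) → β j J = β j J') (T : (Fin d → Fin n) → E) :
    CoordRankLE (n ^ ((k - 1) * d / k)) (fun c => ∑ J, T J * ∏ j, β j J (c j)) := by
  cases isEmpty_or_nonempty (Fin d → Fin n) with
  | inl h =>
    exact .of_fintype hk (S := Empty) (by simp) (fun s => s.elim) fun c => by simp
  | inr h =>
    obtain ⟨J₀⟩ := h
    obtain ⟨j₀, hj₀⟩ := exists_large_fiber hk f
    let e := Equiv.piEquivPiSubtypeProd (fun l => f l = j₀) (fun _ : Fin d => Fin n)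
    -- An arbitrary filler: the factors `j ≠ j₀` ignore the slots in the fibre of `j₀`.
    let t₀ : {l // f l = j₀} → Fin n := (e J₀).1
    refine .of_fintype hk (S := {l // ¬ f l = j₀} → Fin n) ?_
      (fun s j x => if j = j₀ then ∑ t, T (e.symm (t, s)) * β j₀ (e.symm (t, s)) x
        else β j (e.symm (t₀, s)) x) fun c => ?_
    · rw [Fintype.card_fun, Fintype.card_fin, Fintype.card_subtype_compl, Fintype.card_fin]
      rcases Nat.eq_zero_or_pos n with rfl | hn
      · rcases Nat.eq_zero_or_pos d with rfl | hd
        · simp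
        · exact (J₀ ⟨0, hd⟩).elim0
      · refine Nat.pow_le_pow_right hn ((Nat.le_div_iff_mul_le (by omega)).2 ?_)
        obtain ⟨k, rfl⟩ := Nat.exists_eq_add_of_le' hk
        rw [Nat.sub_mul, Nat.add_sub_cancel]
        rw [Nat.mul_comm] at hj₀
        have : d * (k + 1) = k * d + d := by ring
        omega
    · rw [← e.symm.sum_comp, Fintype.sum_prod_type, Finset.sum_comm]
      refine Finset.sum_congr rfl fun s _ => ?_
      rw [← Finset.mul_prod_erase _ _ (Finset.mem_univ j₀), if_pos rfl, Finset.sum_mul]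
      refine Finset.sum_congr rfl fun t _ => ?_
      rw [← Finset.mul_prod_erase _ _ (Finset.mem_univ j₀), ← mul_assoc]
      congr 1
      refine Finset.prod_congr rfl fun j hj => ?_
      have hj' := Finset.ne_of_mem_erase hj
      rw [if_neg hj']
      refine congrFun (hβ j _ _ fun l hl => ?_) _
      have hl' : ¬ f l = j₀ := fun h => hj' (hl.symm.trans h)
      simp [e, Equiv.piEquivPiSubtypeProd, hl']

/-- Polynomial equations for tensors of rank at most `R` persist under field extensions. -/
theorem CoordRankLE.aeval_eq_zero {F : Type*} [Field F] [Infinite F] [Algebra F E] {R : ℕ}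
    {P : MvPolynomial (Fin k → Fin m) F}
    (hP : ∀ t : (Fin k → Fin m) → F, CoordRankLE R t → MvPolynomial.eval t P = 0)
    {t : (Fin k → Fin m) → E} (ht : CoordRankLE R t) : MvPolynomial.aeval t P = 0 := by
  obtain ⟨b, hb⟩ := ht
  let g : (Fin k → Fin m) → MvPolynomial (Fin R × Fin k × Fin m) F :=
    fun c => ∑ i, ∏ j, MvPolynomial.X (i, j, c j)
  -- `P` vanishes on all `F`-values of the generic sum `g` of `R` products, and `F` is infinite.
  have h0 : MvPolynomial.aeval g P = 0 := by
    refine MvPolynomial.funext fun x => ?_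
    rw [map_zero, ← MvPolynomial.aeval_eq_eval, MvPolynomial.comp_aeval_apply,
      MvPolynomial.aeval_eq_eval]
    exact hP _ ⟨fun i j y => x (i, j, y), fun c => by simp [g]⟩
  have h1 := congrArg (MvPolynomial.aeval fun x : Fin R × Fin k × Fin m => b x.1 x.2.1 x.2.2) h0
  rw [map_zero, MvPolynomial.comp_aeval_apply] at h1
  convert h1 using 3
  funext c
  simp [g, hb]

end Coordinates

/-! ### Differentiating a degeneration of the generic image -/

section Core

theorem exists_derivation_fractionRing_mvPolynomial {F τ K : Type*} [Field F] [Field K]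
    [Algebra (MvPolynomial τ F) K] [IsFractionRing (MvPolynomial τ F) K] (i : τ) :
    ∃ D : Derivation ℤ K K,
      ∀ P, D (algebraMap (MvPolynomial τ F) K P) = algebraMap _ K (MvPolynomial.pderiv i P) := by
  have : Algebra.FormallyEtale (MvPolynomial τ F) K :=
    .of_isLocalization (nonZeroDivisors _)
  exact exists_derivation_extension ((Algebra.linearMap (MvPolynomial τ F) K).compDer
    ((MvPolynomial.pderiv i).restrictScalars ℤ))

theorem valuation_aeval_sub_aeval_lt_one {F E Γ ι : Type*} [Field F] [Field E] [Algebra F E]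
    [LinearOrderedCommGroupWithZero Γ] {v : Valuation E Γ} (hF : ∀ a, v (algebraMap F E a) ≤ 1)
    {s t : ι → E} (ht : ∀ i, v (t i) ≤ 1) (hst : ∀ i, v (s i - t i) < 1) (P : MvPolynomial ι F) :
    v (MvPolynomial.aeval s P - MvPolynomial.aeval t P) < 1 := by
  -- Integrality of `P(t)` is carried along for the product case.
  suffices h : v (MvPolynomial.aeval t P) ≤ 1 ∧
      v (MvPolynomial.aeval s P - MvPolynomial.aeval t P) < 1 from h.2
  induction P using MvPolynomial.induction_on with
  | C a => simpa using hF a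
  | add p q hp hq =>
    rw [map_add (MvPolynomial.aeval t), map_add (MvPolynomial.aeval s), add_sub_add_comm]
    exact ⟨(Valuation.map_add _ _ _).trans (max_le hp.1 hq.1), Valuation.map_add_lt _ hp.2 hq.2⟩
  | mul_X p i hp =>
    rw [map_mul (MvPolynomial.aeval t), map_mul (MvPolynomial.aeval s), MvPolynomial.aeval_X,
      MvPolynomial.aeval_X]
    refine ⟨by rw [map_mul]; exact mul_le_one' hp.1 (ht i), ?_⟩
    have hs : v (s i) ≤ 1 := by
      rw [← sub_add_cancel (s i) (t i)]
      exact (Valuation.map_add _ _ _).trans (max_le (hst i).le (ht i))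
    have : MvPolynomial.aeval s p * s i - MvPolynomial.aeval t p * t i =
      (MvPolynomial.aeval s p - MvPolynomial.aeval t p) * s i +
        MvPolynomial.aeval t p * (s i - t i) := by ring
    rw [this]
    refine Valuation.map_add_lt _ ?_ ?_
    · rw [map_mul]
      exact (mul_le_of_le_one_right' hs).trans_lt hp.2
    · rw [map_mul]
      exact (mul_le_of_le_one_left' hp.1).trans_lt (hst i)

/-- If the multilinear map with coefficients `M` takes values of border rank at most `r`, then its
linear extension takes values of border rank at most `r k ^ d n ^ ⌊(k - 1) d / k⌋`. -/
theorem eval_contraction_eq_zero {F : Type*} [Field F] [CharZero F] {n d m k r : ℕ} (hk : 1 ≤ k)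
    (M : (Fin d → Fin n) → (Fin k → Fin m) → F)
    (hM : ∀ P : MvPolynomial (Fin k → Fin m) F,
      (∀ t, CoordRankLE r t → MvPolynomial.eval t P = 0) →
      ∀ x : Fin d → Fin n → F, MvPolynomial.eval (fun c => ∑ J, M J c * ∏ l, x l (J l)) P = 0)
    (T : (Fin d → Fin n) → F) (P : MvPolynomial (Fin k → Fin m) F)
    (hP : ∀ t, CoordRankLE (r * k ^ d * n ^ ((k - 1) * d / k)) t → MvPolynomial.eval t P = 0) :
    MvPolynomial.eval (fun c => ∑ J, T J * M J c) P = 0 := by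
  let A := MvPolynomial (Fin d × Fin n) F
  let K := FractionRing A
  have : CharZero K := charZero_of_injective_algebraMap (algebraMap F K).injective
  let g : (Fin k → Fin m) → MvPolynomial (Fin r × Fin k × Fin m) F :=
    fun c => ∑ i, ∏ j, MvPolynomial.X (i, j, c j)
  let p₀ : (Fin k → Fin m) → A :=
    fun c => ∑ J, MvPolynomial.C (M J c) * ∏ l, MvPolynomial.X (l, J l)
  obtain ⟨E, _, _, _, _, z, v, hvK, hvz, hder⟩ := exists_differential_lift g
    (fun c => algebraMap A K (p₀ c)) (by
      intro Q hQ
      have hQr : ∀ t, CoordRankLE r t → MvPolynomial.eval t Q = 0 := by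
        rintro t ⟨b, hb⟩
        have := congrArg (MvPolynomial.eval fun y : Fin r × Fin k × Fin m => b y.1 y.2.1 y.2.2) hQ
        rw [map_zero, ← MvPolynomial.aeval_eq_eval, MvPolynomial.comp_aeval_apply,
          MvPolynomial.aeval_eq_eval] at this
        convert this using 3
        funext c
        simp [g, hb]
      have h0 : MvPolynomial.aeval p₀ Q = 0 := by
        refine MvPolynomial.funext fun x => ?_
        rw [map_zero, ← MvPolynomial.aeval_eq_eval, MvPolynomial.comp_aeval_apply,
          MvPolynomial.aeval_eq_eval]
        simpa [p₀] using hM Q hQr (fun l i => x (l, i))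
      have := congrArg (IsScalarTower.toAlgHom F A K) h0
      rwa [map_zero, MvPolynomial.comp_aeval_apply] at this)
  choose D hD using
    exists_derivation_fractionRing_mvPolynomial (F := F) (τ := Fin d × Fin n) (K := K)
  choose D' hD' hvD' using fun i => hder (D i)
  let ρ : A →+* E := (algebraMap K E).comp (algebraMap A K)
  have hρ : ∀ i a, D' i (ρ a) = ρ (MvPolynomial.pderiv i a) := fun i a => by
    change D' i (algebraMap K E (algebraMap A K a)) = _
    rw [hD', hD]
    rfl
  have hρC : ∀ a, ρ (MvPolynomial.C a) = algebraMap F E a := fun a => by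
    rw [IsScalarTower.algebraMap_apply F K E, IsScalarTower.algebraMap_apply F A K]
    rfl
  have hvF : ∀ a : F, v (algebraMap F E a) ≤ 1 := fun a => by
    by_cases ha : a = 0
    · simp [ha]
    · rw [IsScalarTower.algebraMap_apply F K E]
      exact (hvK _ (by simpa using ha)).le
  let DJ : (Fin d → Fin n) → Fin d → Derivation ℤ E E := fun J l => D' (l, J l)
  -- The mixed partial derivative along `J` extracts the coefficient of one multilinear monomial.
  have hDp : ∀ J c, iterDer (DJ J) (fun _ => true) (ρ (p₀ c)) = algebraMap F E (M J c) := by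
    intro J c
    simp only [p₀, map_sum, map_mul, map_prod]
    rw [Finset.sum_eq_single J]
    · rw [iterDer_const_mul, iterDer_prod_dual (c := fun _ => 1), hρC]
      · simp
      · intro l l'
        rw [hρ, MvPolynomial.pderiv_X]
        by_cases h : l = l' <;> simp [h, Prod.ext_iff, eq_comm]
      · intro l
        rw [hρ, MvPolynomial.pderiv_C, map_zero]
    · intro J' _ hJ
      rw [iterDer_const_mul,
        iterDer_prod_dual (c := fun l => if J l = J' l then 1 else 0)]
      · obtain ⟨l, hl⟩ := Function.ne_iff.1 hJ
        rw [Finset.prod_eq_zero (Finset.mem_univ l), mul_zero]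
        rw [if_neg (Ne.symm hl), Nat.cast_zero]
      · intro l l'
        rw [hρ, MvPolynomial.pderiv_X]
        by_cases h : l = l'
        · subst h
          by_cases h' : J l = J' l <;> simp [h', Ne.symm]
        · simp [h, Ne.symm h]
      · intro l
        rw [hρ, MvPolynomial.pderiv_C, map_zero]
    · simp
  -- The entries of `z` may have poles; only the smallness of `g(z) - p₀` is used, and the
  -- derivations preserve it.
  let s : (Fin k → Fin m) → E := fun c => ∑ J, algebraMap F E (T J) *
    iterDer (DJ J) (fun _ => true) (MvPolynomial.aeval z (g c))
  let t : (Fin k → Fin m) → E := fun c => algebraMap F E (∑ J, T J * M J c)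
  have hst : ∀ c, v (s c - t c) < 1 := by
    intro c
    simp only [s, t, map_sum, map_mul, ← hDp]
    rw [← Finset.sum_sub_distrib]
    refine Valuation.map_sum_lt _ one_ne_zero fun J _ => ?_
    rw [← mul_sub, ← map_sub, map_mul]
    refine (mul_le_of_le_one_left' (hvF _)).trans_lt ?_
    exact valuation_iterDer_lt_one (fun l x hx => (hvD' (l, J l) x).2 hx) (hvz c)
  have hs : CoordRankLE (r * k ^ d * n ^ ((k - 1) * d / k)) s := by
    have h1 : s = fun c => ∑ x : Fin r × (Fin d → Fin k), ∑ J, algebraMap F E (T J) *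
        ∏ j, iterDer (DJ J) (fun l => decide (x.2 l = j)) (z (x.1, j, c j)) := by
      funext c
      rw [Finset.sum_comm]
      refine Finset.sum_congr rfl fun J _ => ?_
      rw [← Finset.mul_sum, Fintype.sum_prod_type]
      simp only [g, map_sum, map_prod, MvPolynomial.aeval_X]
      simp only [iterDer_prod]
    rw [h1]
    have h2 := CoordRankLE.sum (S := Fin r × (Fin d → Fin k)) hk (fun x =>
      CoordRankLE.contraction (n := n) (d := d) (E := E) (m := m) hk x.2
        (fun j J y => iterDer (DJ J) (fun l => decide (x.2 l = j)) (z (x.1, j, y)))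
        (by
          intro j J J' h
          funext y
          rw [iterDer_congr]
          intro l hl
          simp only [DJ]
          rw [h l (by simpa using hl)])
        (fun J => algebraMap F E (T J)))
    simpa using h2
  have hsP : MvPolynomial.aeval s P = 0 := CoordRankLE.aeval_eq_zero hP hs
  have hlt := valuation_aeval_sub_aeval_lt_one hvF (fun c => hvF _) hst P
  have htP : MvPolynomial.aeval t P =
      algebraMap F E (MvPolynomial.eval (fun c => ∑ J, T J * M J c) P) := by
    rw [← MvPolynomial.aeval_eq_eval]
    exact MvPolynomial.aeval_algebraMap_apply E _ P
  -- The value of `P` at `t` comes from `F`, where `v` is trivial, so valuation below 1 forces it to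
  -- be 0.
  rw [hsP, zero_sub, Valuation.map_neg, htP, IsScalarTower.algebraMap_apply F K E] at hlt
  by_contra h
  exact hlt.ne (hvK _ (by simpa using h))

end Core

/-! ### Border rank in coordinates and the final bound -/

section CoordinateDescription

/-- The standard basis of `Ten F n d`. -/
noncomputable def tenBasis (F : Type*) [Field F] (n d : ℕ) :
    Module.Basis (Fin d → Fin n) F (Ten F n d) :=
  Basis.piTensorProduct fun _ => Pi.basisFun F (Fin n)

theorem tenBasis_coord_tprod {F : Type*} [Field F] {n d : ℕ} (v : Fin d → Fin n → F)
    (J : Fin d → Fin n) :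
    (tenBasis F n d).coord J (PiTensorProduct.tprod F v) = ∏ l, v l (J l) := by
  simp [tenBasis]

/-- Every functional is a linear form in the coordinates, so substitution leaves finitely many
variables. -/
theorem mem_zariskiClosure_iff_coord {F V ι : Type*} [Field F] [AddCommGroup V] [Module F V]
    [Finite ι] (b : Module.Basis ι F V) (Z : Set V) (x : V) :
    x ∈ zariskiClosure F Z ↔ ∀ P : MvPolynomial ι F,
      (∀ z ∈ Z, MvPolynomial.eval (fun c => b.coord c z) P = 0) →
        MvPolynomial.eval (fun c => b.coord c x) P = 0 := by
  cases nonempty_fintype ι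
  constructor
  · intro h P hP
    have := h (MvPolynomial.rename b.coord P) fun z hz => by
      rw [MvPolynomial.eval_rename]
      exact hP z hz
    rwa [MvPolynomial.eval_rename] at this
  · intro h p hp
    have key : ∀ y : V, MvPolynomial.eval (fun c => b.coord c y)
        (MvPolynomial.aeval (fun l : Module.Dual F V =>
          ∑ c, MvPolynomial.C (l (b c)) * (MvPolynomial.X c : MvPolynomial ι F)) p) =
        MvPolynomial.eval (fun l : Module.Dual F V => l y) p := by
      intro y
      rw [← MvPolynomial.aeval_eq_eval, MvPolynomial.comp_aeval_apply, MvPolynomial.aeval_eq_eval]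
      have : (fun l : Module.Dual F V => MvPolynomial.aeval (R := F) (fun c => b.coord c y)
          (∑ c, MvPolynomial.C (l (b c)) * (MvPolynomial.X c : MvPolynomial ι F))) =
          fun l : Module.Dual F V => l y := by
        funext l
        conv_rhs => rw [← b.sum_repr y, map_sum]
        simp [mul_comm]
      rw [this]
    rw [← key]
    exact h _ fun z hz => by rw [key]; exact hp z hz

theorem tensorRank_le_iff_coordRankLE {F : Type*} [Field F] {m k : ℕ} (hk : 1 ≤ k) {R : ℕ}
    (T : Ten F m k) :
    tensorRank T ≤ R ↔ CoordRankLE R (fun c => (tenBasis F m k).coord c T) := by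
  constructor
  · intro h
    obtain ⟨s, hs, hT⟩ := tensorRank_spec hk T
    choose v hv using hs
    refine .of_fintype hk (S := Fin (tensorRank T)) (by simpa using h) v fun c => ?_
    conv_lhs => rw [hT, map_sum]
    simp only [hv, tenBasis_coord_tprod]
  · rintro ⟨b, hb⟩
    refine Nat.sInf_le ⟨fun i => PiTensorProduct.tprod F (b i), fun i => ⟨_, rfl⟩, ?_⟩
    refine (tenBasis F m k).ext_elem fun c => ?_
    rw [← Module.Basis.coord_apply, ← Module.Basis.coord_apply, map_sum]
    refine (hb c).trans ?_
    simp only [tenBasis_coord_tprod]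

theorem mem_zariskiClosure_tensorRank_iff {F : Type*} [Field F] {m k : ℕ} (hk : 1 ≤ k) {R : ℕ}
    (T : Ten F m k) :
    T ∈ zariskiClosure F {T' : Ten F m k | tensorRank T' ≤ R} ↔
      ∀ P : MvPolynomial (Fin k → Fin m) F,
        (∀ t, CoordRankLE R t → MvPolynomial.eval t P = 0) →
          MvPolynomial.eval (fun c => (tenBasis F m k).coord c T) P = 0 := by
  rw [mem_zariskiClosure_iff_coord (tenBasis F m k)]
  refine forall_congr' fun P => imp_congr_left ⟨fun h t ht => ?_, fun h z hz => ?_⟩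
  · have ht' : (fun c => (tenBasis F m k).coord c ((tenBasis F m k).equivFun.symm t)) = t := by
      funext c
      simp [Finsupp.single_apply]
    rw [← ht'] at ht ⊢
    exact h _ ((tensorRank_le_iff_coordRankLE hk _).2 ht)
  · exact h _ ((tensorRank_le_iff_coordRankLE hk z).1 hz)

theorem mem_zariskiClosure_tensorRank_of_borderRank_le {F : Type*} [Field F] {m k : ℕ} {R : ℕ}
    {T : Ten F m k} (hT : borderRank T ≤ R) :
    T ∈ zariskiClosure F {T' : Ten F m k | tensorRank T' ≤ R} :=
  fun p hp => borderRank_spec T p fun z hz => hp z (le_trans hz hT)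

theorem borderRank_le_of_simpleTensors {F : Type*} [Field F] [CharZero F] {n d m k r : ℕ}
    (hk : 1 ≤ k) (φ : Ten F n d →ₗ[F] Ten F m k)
    (hφ : ∀ s ∈ simpleTensors F n d, borderRank (φ s) ≤ r) (T : Ten F n d) :
    borderRank (φ T) ≤ r * k ^ d * n ^ ((k - 1) * d / k) := by
  let M : (Fin d → Fin n) → (Fin k → Fin m) → F :=
    fun J c => (tenBasis F m k).coord c (φ (tenBasis F n d J))
  have hcoord : ∀ (T : Ten F n d) c, (tenBasis F m k).coord c (φ T) =
      ∑ J, (tenBasis F n d).coord J T * M J c := by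
    intro T c
    conv_lhs => rw [← (tenBasis F n d).sum_repr T, map_sum, map_sum]
    simp [M]
  refine Nat.sInf_le ((mem_zariskiClosure_tensorRank_iff hk _).2 fun P hP => ?_)
  simp only [hcoord]
  refine eval_contraction_eq_zero hk M (r := r) (fun Q hQ x => ?_) _ P hP
  have := (mem_zariskiClosure_tensorRank_iff hk _).1
    (mem_zariskiClosure_tensorRank_of_borderRank_le (hφ _ ⟨x, rfl⟩)) Q hQ
  simpa only [hcoord, tenBasis_coord_tprod, mul_comm] using this

end CoordinateDescription

end BorderPotency

theorem theorem6p9 {F : Type*} [Field F] [IsAlgClosed F] [CharZero F] (n d m k : ℕ) (hk : 1 ≤ k)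
    (φ : BorderPotency.Ten F n d →ₗ[F] BorderPotency.Ten F m k) :
    BorderPotency.borderPotency φ ≤ (k : ℝ) ^ d * (n : ℝ) ^ ((k - 1) * d / k) := by
  obtain ⟨⟨T, -, hT⟩, -⟩ := BorderPotency.isGreatest_maxBorderRank hk φ Set.univ_nonempty
  have hs := (BorderPotency.isGreatest_maxBorderRank hk φ
    (A := BorderPotency.simpleTensors F n d) ⟨_, 0, rfl⟩).2
  have h := BorderPotency.borderRank_le_of_simpleTensors hk φ (fun s h => hs ⟨s, h, rfl⟩) T
  simp only at hT
  rw [hT] at h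
  -- This also covers a zero denominator, where the quotient is 0.
  refine div_le_of_le_mul₀ (by positivity) (by positivity) ?_
  calc ((BorderPotency.maxBorderRank φ Set.univ : ℕ) : ℝ) ≤
      ((BorderPotency.maxBorderRank φ (BorderPotency.simpleTensors F n d) * k ^ d *
        n ^ ((k - 1) * d / k) : ℕ) : ℝ) := by exact_mod_cast h
    _ = _ := by push_cast; ring
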